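/- All spaces are real. For $1\le p\le\infty$, a \emph{$p$-multinormed space} is a Banach space $X$ together with norms $\|\cdot\|_m$ on the algebraic tensor products $\ell^p_m\otimes X$ ($m\in\mathbb N$) such that (1) $\|a\otimes x\|_m=\|a\|\,\|x\|$ for $a\in\ell^p_m$, $x\in X$; (2) $|\langle a^*\otimes x^*,z\rangle|\le\|z\|_m$ for $z\in\ell^p_m\otimes X$ and all $a^*\in(\ell^p_m)^*$, $x^*\in X^*$ of norm at most $1$; (3) $\|(T\otimes I_X)z\|_k\le\|T\|\,\|z\|_m$ for every linear $T:\ell^p_m\to\ell^p_k$ and $z\in\ell^p_m\otimes X$. The \emph{$p$-norm} of a linear map $u:X\to Y$ between $p$-multinormed spaces is $\|u\|_p=\sup_m\|I_{\ell^p_m}\otimes u:\ell^p_m\otimes X\to\ell^p_m\otimes Y\|$, and $u$ is \emph{$p$-multibounded} if $\|u\|_p<\infty$. A linear map $q:Y\to X$ is a \emph{$p$-quotient map} if, for every $m$, $I_{\ell^p_m}\otimes q$ maps the open unit ball of $\ell^p_m\otimes Y$ onto the open unit ball of $\ell^p_m\otimes X$. A $p$-multinormed space $Z$ is \emph{$1$-projective}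 if for every $\varepsilon>0$, every $p$-quotient map $q:Y\to X$ of $p$-multinormed spaces and every $p$-multibounded $u:Z\to X$ there is a linear $\tilde u:Z\to Y$ with $q\tilde u=u$ and $\|\tilde u\|_p\le\|u\|_p+\varepsilon$. For a Banach space $E$, $\mathrm{min}_p(E)$ is $E$ with $\ell^p_m\otimes E$ carrying the injective tensor norm. \textbf{Proposition.} Let $1\le p\le\infty$, $1/p+1/p'=1$, and $n\in\mathbb N$. Then $\mathrm{min}_p(\ell^{p'}_n)$ is $1$-projective as a $p$-multinormed space. Moreover, for every $p$-quotient map $q:Y\to X$ of $p$-multinormed spaces, every $p$-multibounded $u:\mathrm{min}_p(\ell^{p'}_n)\to X$ and every $\varepsilon>0$ there is a linear $\tilde u:\ell^{p'}_n\to Y$ with $q\tilde u=u$ and $\|\tilde u\|_p\le(1+\varepsilon)\|u\|_p$. -/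

import Mathlib

open scoped ENNReal NNReal TensorProduct

universe u v w

/-- The finite-dimensional real space `ℓ^p_n`. -/
abbrev FinLp (p : ℝ≥0∞) (n : ℕ) : Type := PiLp p (fun _ : Fin n => ℝ)

section Pairing

variable {E F : Type*} [NormedAddCommGroup E] [NormedSpace ℝ E]
  [NormedAddCommGroup F] [NormedSpace ℝ F]

/-- The functional `u ↦ ⟨f ⊗ φ, u⟩` on the algebraic tensor product `E ⊗ F`, determined by
`⟨f ⊗ φ, a ⊗ x⟩ = f a * φ x`. -/
noncomputable def tensorPairing (f : StrongDual ℝ E) (φ : StrongDual ℝ F) : E ⊗[ℝ] F →ₗ[ℝ] ℝ :=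
  TensorProduct.dualDistrib ℝ E F ((f : E →ₗ[ℝ] ℝ) ⊗ₜ[ℝ] (φ : F →ₗ[ℝ] ℝ))

@[simp]
theorem tensorPairing_tmul (f : StrongDual ℝ E) (φ : StrongDual ℝ F) (a : E) (x : F) :
    tensorPairing f φ (a ⊗ₜ[ℝ] x) = f a * φ x := by
  simp [tensorPairing]

/-- Pairs of functionals in the closed dual unit balls. -/
abbrev DualBallPair (E F : Type*) [NormedAddCommGroup E] [NormedSpace ℝ E]
    [NormedAddCommGroup F] [NormedSpace ℝ F] : Type _ :=
  {g : StrongDual ℝ E × StrongDual ℝ F // ‖g.1‖ ≤ 1 ∧ ‖g.2‖ ≤ 1}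

theorem tensorPairing_bddAbove (u : E ⊗[ℝ] F) :
    BddAbove (Set.range fun g : DualBallPair E F => |tensorPairing g.1.1 g.1.2 u|) := by
  induction u using TensorProduct.induction_on with
  | zero => exact ⟨0, by rintro _ ⟨g, rfl⟩; simp⟩
  | tmul a x =>
    refine ⟨‖a‖ * ‖x‖, ?_⟩
    rintro _ ⟨g, rfl⟩
    simp only [tensorPairing_tmul, abs_mul]
    have h1 : |g.1.1 a| ≤ ‖a‖ := g.1.1.le_of_opNorm_le g.2.1 a |>.trans (by simp)
    have h2 : |g.1.2 x| ≤ ‖x‖ := g.1.2.le_of_opNorm_le g.2.2 x |>.trans (by simp)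
    gcongr
  | add u v hu hv =>
    obtain ⟨A, hA⟩ := hu
    obtain ⟨B, hB⟩ := hv
    refine ⟨A + B, ?_⟩
    rintro _ ⟨g, rfl⟩
    simp only [map_add]
    exact (abs_add_le _ _).trans (add_le_add (hA ⟨g, rfl⟩) (hB ⟨g, rfl⟩))

/-- The injective tensor norm
`‖u‖ = sup {|⟨f ⊗ φ, u⟩| : f ∈ E*, φ ∈ F*, ‖f‖ ≤ 1, ‖φ‖ ≤ 1}` on the algebraic tensor product. -/
noncomputable def injectiveTensorNorm (E F : Type*) [NormedAddCommGroup E] [NormedSpace ℝ E]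
    [NormedAddCommGroup F] [NormedSpace ℝ F] : Seminorm ℝ (E ⊗[ℝ] F) :=
  Seminorm.of (fun u => ⨆ g : DualBallPair E F, |tensorPairing g.1.1 g.1.2 u|)
    (by
      intro u v
      have : Nonempty (DualBallPair E F) := ⟨⟨0, by simp⟩⟩
      refine ciSup_le fun g => ?_
      rw [map_add]
      exact (abs_add_le _ _).trans
        (add_le_add (le_ciSup (tensorPairing_bddAbove u) g)
          (le_ciSup (tensorPairing_bddAbove v) g)))
    (by
      intro c u
      simp only [map_smul, smul_eq_mul, abs_mul, Real.norm_eq_abs]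
      exact (Real.mul_iSup_of_nonneg (abs_nonneg c) _).symm)

theorem injectiveTensorNorm_apply (u : E ⊗[ℝ] F) :
    injectiveTensorNorm E F u = ⨆ g : DualBallPair E F, |tensorPairing g.1.1 g.1.2 u| := rfl

theorem abs_tensorPairing_le_injectiveTensorNorm (f : StrongDual ℝ E) (φ : StrongDual ℝ F)
    (u : E ⊗[ℝ] F) :
    |tensorPairing f φ u| ≤ ‖f‖ * ‖φ‖ * injectiveTensorNorm E F u := by
  have hs : ∀ (a b : ℝ), tensorPairing (a • f) (b • φ) u = a * b * tensorPairing f φ u := by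
    intro a b
    induction u using TensorProduct.induction_on with
    | zero => simp
    | tmul c x => simp only [tensorPairing_tmul, smul_apply, smul_eq_mul]; ring
    | add c d hc hd => rw [map_add, map_add, hc, hd]; ring
  by_cases hf : f = 0
  · subst hf
    simp [tensorPairing]
  by_cases hφ : φ = 0
  · subst hφ
    simp [tensorPairing]
  have hf' : 0 < ‖f‖ := norm_pos_iff.mpr hf
  have hφ' : 0 < ‖φ‖ := norm_pos_iff.mpr hφ
  have h := le_ciSup (tensorPairing_bddAbove u)
    (⟨(‖f‖⁻¹ • f, ‖φ‖⁻¹ • φ), by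
      constructor <;> simp [norm_smul, hf'.ne', hφ'.ne']⟩ : DualBallPair E F)
  rw [← injectiveTensorNorm_apply] at h
  simp only [hs, abs_mul, abs_inv, abs_norm] at h
  calc |tensorPairing f φ u|
      = ‖f‖ * ‖φ‖ * (‖f‖⁻¹ * ‖φ‖⁻¹ * |tensorPairing f φ u|) := by field_simp
    _ ≤ _ := by gcongr

theorem injectiveTensorNorm_le {u : E ⊗[ℝ] F} {C : ℝ}
    (h : ∀ f : StrongDual ℝ E, ∀ φ : StrongDual ℝ F, ‖f‖ ≤ 1 → ‖φ‖ ≤ 1 →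
      |tensorPairing f φ u| ≤ C) : injectiveTensorNorm E F u ≤ C := by
  have : Nonempty (DualBallPair E F) := ⟨⟨0, by simp⟩⟩
  exact ciSup_le fun g => h _ _ g.2.1 g.2.2

theorem injectiveTensorNorm_tmul (a : E) (x : F) :
    injectiveTensorNorm E F (a ⊗ₜ[ℝ] x) = ‖a‖ * ‖x‖ := by
  apply le_antisymm
  · refine injectiveTensorNorm_le fun f φ hf hφ => ?_
    rw [tensorPairing_tmul, abs_mul]
    have h1 : |f a| ≤ ‖a‖ := f.le_of_opNorm_le hf a |>.trans (by simp)
    have h2 : |φ x| ≤ ‖x‖ := φ.le_of_opNorm_le hφ x |>.trans (by simp)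
    gcongr
  · obtain ⟨f, hf, hfa⟩ := exists_dual_vector'' ℝ a
    obtain ⟨φ, hφ, hφx⟩ := exists_dual_vector'' ℝ x
    have h := abs_tensorPairing_le_injectiveTensorNorm f φ (a ⊗ₜ[ℝ] x)
    rw [tensorPairing_tmul, hfa, hφx] at h
    simp only [RCLike.ofReal_real_eq_id, id_eq, abs_mul, abs_norm] at h
    refine h.trans ?_
    have h0 : 0 ≤ injectiveTensorNorm E F (a ⊗ₜ[ℝ] x) := apply_nonneg _ _
    calc ‖f‖ * ‖φ‖ * injectiveTensorNorm E F (a ⊗ₜ[ℝ] x)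
        ≤ 1 * 1 * injectiveTensorNorm E F (a ⊗ₜ[ℝ] x) := by gcongr
      _ = _ := by ring

theorem tensorPairing_rTensor {E' : Type*} [NormedAddCommGroup E'] [NormedSpace ℝ E']
    (T : E →L[ℝ] E') (f : StrongDual ℝ E') (φ : StrongDual ℝ F) (u : E ⊗[ℝ] F) :
    tensorPairing f φ ((T : E →ₗ[ℝ] E').rTensor F u) = tensorPairing (f.comp T) φ u := by
  induction u using TensorProduct.induction_on with
  | zero => simp
  | tmul a x => simp
  | add u v hu hv => simp only [map_add, hu, hv]

theorem injectiveTensorNorm_rTensor_le {E' : Type*} [NormedAddCommGroup E'] [NormedSpace ℝ E']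
    (T : E →L[ℝ] E') (u : E ⊗[ℝ] F) :
    injectiveTensorNorm E' F ((T : E →ₗ[ℝ] E').rTensor F u) ≤
      ‖T‖ * injectiveTensorNorm E F u := by
  refine injectiveTensorNorm_le fun f φ hf hφ => ?_
  rw [tensorPairing_rTensor]
  refine (abs_tensorPairing_le_injectiveTensorNorm _ _ _).trans ?_
  have h0 : 0 ≤ injectiveTensorNorm E F u := apply_nonneg _ _
  have h1 : ‖f.comp T‖ ≤ ‖T‖ := (f.opNorm_comp_le T).trans
    (by nlinarith [norm_nonneg T])
  calc ‖f.comp T‖ * ‖φ‖ * injectiveTensorNorm E F u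
      ≤ ‖T‖ * 1 * injectiveTensorNorm E F u := by gcongr
    _ = _ := by ring

end Pairing

/-- A `p`-multinorm structure on the real normed space `X`: a tensorial sequence of cross-norms
on the algebraic tensor products `ℓ^p_m ⊗ X`, `m ∈ ℕ`.  A `p`-multinormed space is a Banach
space with such a structure.  Definiteness of the seminorms follows from `pairing_le`; see
`Multinorm.eq_zero_of_norm_eq_zero`. -/
structure Multinorm (p : ℝ≥0∞) [Fact (1 ≤ p)] (X : Type*) [NormedAddCommGroup X]
    [NormedSpace ℝ X] where
  /-- The norm on `ℓ^p_m ⊗ X`. -/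
  norm : ∀ m : ℕ, Seminorm ℝ (FinLp p m ⊗[ℝ] X)
  norm_tmul : ∀ (m : ℕ) (a : FinLp p m) (x : X), norm m (a ⊗ₜ[ℝ] x) = ‖a‖ * ‖x‖
  pairing_le : ∀ (m : ℕ) (u : FinLp p m ⊗[ℝ] X) (f : StrongDual ℝ (FinLp p m))
    (φ : StrongDual ℝ X), ‖f‖ ≤ 1 → ‖φ‖ ≤ 1 → |tensorPairing f φ u| ≤ norm m u
  tensorial : ∀ (m k : ℕ) (T : FinLp p m →L[ℝ] FinLp p k) (u : FinLp p m ⊗[ℝ] X),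
    norm k ((T : FinLp p m →ₗ[ℝ] FinLp p k).rTensor X u) ≤ ‖T‖ * norm m u

namespace Multinorm

variable {p : ℝ≥0∞} [Fact (1 ≤ p)]
  {X : Type*} [NormedAddCommGroup X] [NormedSpace ℝ X]
  {Y : Type*} [NormedAddCommGroup Y] [NormedSpace ℝ Y]

/-- The functions in a multinorm structure are norms, not only seminorms. -/
theorem eq_zero_of_norm_eq_zero (A : Multinorm p X) (m : ℕ) (u : FinLp p m ⊗[ℝ] X)
    (hu : A.norm m u = 0) : u = 0 := by
  set b := PiLp.basisFun p ℝ (Fin m)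
  have key : ∀ (f : StrongDual ℝ (FinLp p m)) (φ : StrongDual ℝ X), tensorPairing f φ u = 0 := by
    intro f φ
    have h1 := abs_tensorPairing_le_injectiveTensorNorm f φ u
    have h2 : injectiveTensorNorm (FinLp p m) X u ≤ 0 :=
      injectiveTensorNorm_le fun f φ hf hφ => (A.pairing_le m u f φ hf hφ).trans hu.le
    have h3 : |tensorPairing f φ u| ≤ 0 :=
      h1.trans (mul_nonpos_of_nonneg_of_nonpos (by positivity) h2)
    exact abs_nonpos_iff.mp h3
  have hform : ∀ v : FinLp p m ⊗[ℝ] X, ∃ x : Fin m → X, v = ∑ i, b i ⊗ₜ[ℝ] x i := by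
    intro v
    induction v using TensorProduct.induction_on with
    | zero => exact ⟨0, by simp⟩
    | tmul a y =>
      refine ⟨fun i => b.repr a i • y, ?_⟩
      conv_lhs => rw [← b.sum_repr a]
      rw [TensorProduct.sum_tmul]
      exact Finset.sum_congr rfl fun i _ => TensorProduct.smul_tmul _ _ _
    | add v w hv hw =>
      obtain ⟨x, hx⟩ := hv
      obtain ⟨y, hy⟩ := hw
      exact ⟨x + y, by simp [hx, hy, TensorProduct.tmul_add, Finset.sum_add_distrib]⟩
  obtain ⟨x, hx⟩ := hform u
  have hx0 : ∀ i, x i = 0 := by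
    intro i
    refine (SeparatingDual.eq_zero_iff_forall_dual_eq_zero (R := ℝ) (x i)).mpr fun φ => ?_
    have h := key (PiLp.proj p (fun _ : Fin m => ℝ) i) φ
    rw [hx] at h
    simpa [b, Pi.single_apply, Finset.sum_ite_eq] using h
  rw [hx]
  simp [hx0]

/-- The minimal `p`-multinorm structure: `ℓ^p_m ⊗ X` carries the injective tensor norm. -/
noncomputable def minimal (p : ℝ≥0∞) [Fact (1 ≤ p)] (X : Type*) [NormedAddCommGroup X]
    [NormedSpace ℝ X] : Multinorm p X where
  norm m := injectiveTensorNorm (FinLp p m) X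
  norm_tmul _ a x := injectiveTensorNorm_tmul a x
  pairing_le _ u f φ hf hφ :=
    le_ciSup (tensorPairing_bddAbove u) (⟨(f, φ), hf, hφ⟩ : DualBallPair _ _)
  tensorial _ _ T u := injectiveTensorNorm_rTensor_le T u

/-- The `p`-norm `‖u‖_p = sup_m ‖I ⊗ u : ℓ^p_m ⊗ X → ℓ^p_m ⊗ Y‖ ∈ [0, ∞]` of a linear map. -/
noncomputable def opNorm (A : Multinorm p X) (B : Multinorm p Y) (u : X →ₗ[ℝ] Y) : ℝ≥0∞ :=
  ⨆ (m : ℕ) (z : FinLp p m ⊗[ℝ] X) (_ : A.norm m z ≤ 1),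
    ENNReal.ofReal (B.norm m (u.lTensor (FinLp p m) z))

/-- `u` is `p`-multibounded: its `p`-norm is finite. -/
def IsMultibounded (A : Multinorm p X) (B : Multinorm p Y) (u : X →ₗ[ℝ] Y) : Prop :=
  opNorm A B u < ∞

/-- `q` is a `p`-quotient map: for each `m`, `I ⊗ q` maps the open unit ball of `ℓ^p_m ⊗ Y`
onto the open unit ball of `ℓ^p_m ⊗ X`; that is, `ℓ^p_m ⊗ X` carries the quotient norm. -/
def IsQuotientMap (B : Multinorm p Y) (A : Multinorm p X) (q : Y →ₗ[ℝ] X) : Prop :=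
  ∀ m : ℕ, (q.lTensor (FinLp p m)) '' {w | B.norm m w < 1} = {z | A.norm m z < 1}

/-- `1`-projectivity of a `p`-multinormed space `Z`: for all `p`-multinormed (Banach) spaces
`X`, `Y`, every `p`-quotient map `q : Y → X`, every `p`-multibounded `u : Z → X` and every
`ε > 0` there is a lifting `u' : Z → Y` with `q u' = u` and `‖u'‖_p ≤ ‖u‖_p + ε`. -/
def IsOneProjective {Z : Type u} [NormedAddCommGroup Z] [NormedSpace ℝ Z]
    (C : Multinorm p Z) : Prop :=
  ∀ (X : Type v) [NormedAddCommGroup X] [NormedSpace ℝ X] [CompleteSpace X]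
    (Y : Type w) [NormedAddCommGroup Y] [NormedSpace ℝ Y] [CompleteSpace Y]
    (A : Multinorm p X) (B : Multinorm p Y) (q : Y →ₗ[ℝ] X), IsQuotientMap B A q →
    ∀ u : Z →ₗ[ℝ] X, IsMultibounded C A u → ∀ ε : ℝ≥0, 0 < ε →
      ∃ u' : Z →ₗ[ℝ] Y, q ∘ₗ u' = u ∧ opNorm C B u' ≤ opNorm C A u + ε

end Multinorm

/-! ### Duality between `ℓ^p_n` and `ℓ^{p'}_n`. -/

section Holder

variable {p p' : ℝ≥0∞} [Fact (1 ≤ p)] [Fact (1 ≤ p')] {n : ℕ}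

/-! A linear map `u` on `ℓ^{p'}_n` is the same thing as one tensor `t_u = ∑ eᵢ ⊗ u(eᵢ)` in `ℓ^p_n ⊗
X`, and its `p`-norm on `min_p(ℓ^{p'}_n)` is exactly the norm of `t_u`
(`Multinorm.opNorm_minimal_eq`). Lifting `u` is therefore lifting a single tensor, which the
quotient property at level `n` does after rescaling
(`Multinorm.exists_lift_of_norm_coordTensor_lt`).

The norm identity has two halves. By the converse of Hölder, `t_id` has injective norm at most 1,
and `I ⊗ u` sends it to `t_u`. By Hölder, every `w` in `ℓ^p_m ⊗ ℓ^{p'}_n` is `(T ⊗ I) t_id` with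
`‖T‖` at most the injective norm of `w`, so `(I ⊗ u) w = (T ⊗ I) t_u` and tensoriality bounds it. -/

theorem FinLp.norm_eq_rpow_sum (hp : p ≠ ∞) (a : FinLp p n) :
    ‖a‖ = (∑ i, |a i| ^ p.toReal) ^ (1 / p.toReal) := by
  have : 0 < p.toReal :=
    ENNReal.toReal_pos (zero_lt_one.trans_le Fact.out).ne' hp
  simpa using PiLp.norm_eq_sum this a

/-- The case `p = ∞` of Hölder's inequality. -/
theorem FinLp.abs_sum_mul_le_one_top (a : FinLp ∞ n) (b : FinLp 1 n) :
    |∑ i, a i * b i| ≤ ‖a‖ * ‖b‖ := by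
  rw [PiLp.norm_eq_of_L1, Finset.mul_sum]
  refine (Finset.abs_sum_le_sum_abs _ _).trans (Finset.sum_le_sum fun i _ => ?_)
  rw [abs_mul]
  exact mul_le_mul_of_nonneg_right (PiLp.norm_apply_le a i) (abs_nonneg _)

/-- Hölder's inequality on `ℝⁿ`, for all conjugate exponents in `[1, ∞]`. -/
theorem FinLp.abs_sum_mul_le (hp : ENNReal.HolderConjugate p p') (a : FinLp p n)
    (b : FinLp p' n) : |∑ i, a i * b i| ≤ ‖a‖ * ‖b‖ := by
  rcases eq_or_ne p ∞ with rfl | hpt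
  · obtain rfl : p' = 1 := ENNReal.HolderConjugate.unique ∞ p' 1
    exact FinLp.abs_sum_mul_le_one_top a b
  rcases eq_or_ne p' ∞ with rfl | hpt'
  · have := hp.symm
    obtain rfl : p = 1 := ENNReal.HolderConjugate.unique ∞ p 1
    simpa only [mul_comm] using FinLp.abs_sum_mul_le_one_top b a
  have h := ENNReal.HolderConjugate.toReal_of_ne_top hpt hpt'
  rw [FinLp.norm_eq_rpow_sum hpt, FinLp.norm_eq_rpow_sum hpt']
  refine (Finset.abs_sum_le_sum_abs _ _).trans ?_
  simpa only [abs_mul, abs_abs] using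
    Real.inner_le_Lp_mul_Lq Finset.univ (fun i => |a i|) (fun i => |b i|) h

/-- The converse of Hölder's inequality: a vector `b` whose pairing with every `a ∈ ℓ^p_n` is at
most `C * ‖a‖` has norm at most `C` in `ℓ^{p'}_n`. -/
theorem FinLp.norm_le_of_forall_sum_mul_le (hp : ENNReal.HolderConjugate p p') (b : FinLp p' n)
    {C : ℝ} (hC : 0 ≤ C) (h : ∀ a : FinLp p n, ∑ i, a i * b i ≤ C * ‖a‖) : ‖b‖ ≤ C := by
  have sign_mul : ∀ x : ℝ, (SignType.sign x : ℝ) * x = |x| := sign_mul_self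
  have abs_sign : ∀ x : ℝ, |(SignType.sign x : ℝ)| ≤ 1 := fun x => by
    rcases lt_trichotomy x 0 with hx | rfl | hx <;> simp [*]
  rcases eq_or_ne p ∞ with rfl | hpt
  · obtain rfl : p' = 1 := ENNReal.HolderConjugate.unique ∞ p' 1
    -- The sign vector of `b` attains the `ℓ^1` norm.
    let a : FinLp ∞ n := WithLp.toLp ∞ fun i => (SignType.sign (b i) : ℝ)
    have ha : ‖a‖ ≤ 1 := by
      rw [PiLp.norm_eq_ciSup]
      exact Real.iSup_le (fun i => abs_sign (b i)) zero_le_one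
    rw [PiLp.norm_eq_of_L1]
    calc ∑ i, ‖b i‖ = ∑ i, a i * b i := by simp [a, sign_mul]
      _ ≤ C * ‖a‖ := h a
      _ ≤ C := mul_le_of_le_one_right hC ha
  rcases eq_or_ne p' ∞ with rfl | hpt'
  · rw [PiLp.norm_eq_ciSup]
    refine Real.iSup_le (fun i => ?_) hC
    -- Testing on a signed basis vector isolates `|b i|`.
    have h1 := h (PiLp.single p i (SignType.sign (b i) : ℝ))
    simp only [PiLp.single_apply, ite_mul, zero_mul, Finset.sum_ite_eq', Finset.mem_univ,
      if_true, sign_mul, PiLp.norm_single] at h1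
    exact h1.trans (mul_le_of_le_one_right hC (abs_sign _))
  have hc := (ENNReal.HolderConjugate.toReal_of_ne_top hpt hpt').symm
  -- `g` is a nonnegative extremal vector for `|b|`; the signs of `b` are restored in `a`.
  obtain ⟨g, hg, hgb⟩ := (NNReal.isGreatest_Lp Finset.univ (fun i => ‖b i‖₊) hc).1
  let a : FinLp p n := WithLp.toLp p fun i => (SignType.sign (b i) : ℝ) * g i
  have ha : ‖a‖ ≤ 1 := by
    rw [FinLp.norm_eq_rpow_sum hpt]
    refine Real.rpow_le_one (by positivity) ?_ (by positivity)
    have hg' : ∑ i, (g i : ℝ) ^ p.toReal ≤ 1 := by exact_mod_cast hg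
    refine (Finset.sum_le_sum fun i _ => ?_).trans hg'
    refine Real.rpow_le_rpow (abs_nonneg _) ?_ ENNReal.toReal_nonneg
    simp only [a, abs_mul, NNReal.abs_eq]
    exact mul_le_of_le_one_left (g i).2 (abs_sign _)
  have hb : ‖b‖ = ∑ i, |b i| * g i := by
    rw [FinLp.norm_eq_rpow_sum hpt']
    have := congrArg ((↑) : ℝ≥0 → ℝ) hgb
    push_cast at this
    simpa using this.symm
  calc ‖b‖ = ∑ i, a i * b i := by
        rw [hb]
        refine Finset.sum_congr rfl fun i _ => ?_
        rw [← sign_mul]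
        simp only [a]
        ring
    _ ≤ C * ‖a‖ := h a
    _ ≤ C := mul_le_of_le_one_right hC ha

end Holder

/-! ### Linear maps on `ℓ^{p'}_n` as tensors. -/

section CoordTensor

variable {p p' : ℝ≥0∞} [Fact (1 ≤ p)] {n : ℕ}
  {X : Type*} [NormedAddCommGroup X] [NormedSpace ℝ X]

/-- The tensor `∑ eᵢ ⊗ u(eᵢ)` in `ℓ^p_n ⊗ X` attached to a linear map `u : ℓ^{p'}_n → X`. -/
noncomputable def coordTensor (p : ℝ≥0∞) [Fact (1 ≤ p)] (u : FinLp p' n →ₗ[ℝ] X) :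
    FinLp p n ⊗[ℝ] X :=
  ∑ i, PiLp.basisFun p ℝ (Fin n) i ⊗ₜ[ℝ] u (PiLp.basisFun p' ℝ (Fin n) i)

/-- Naturality: it turns the lifting equation `q ∘ₗ u' = u` into an equation between tensors. -/
theorem lTensor_coordTensor {Z Y : Type*} [NormedAddCommGroup Y] [NormedSpace ℝ Y]
    [NormedAddCommGroup Z] [NormedSpace ℝ Z] (v : Z →ₗ[ℝ] Y) (u : FinLp p' n →ₗ[ℝ] Z) :
    v.lTensor (FinLp p n) (coordTensor p u) = coordTensor p (v ∘ₗ u) := by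
  simp [coordTensor]

theorem coordTensor_injective :
    Function.Injective (coordTensor p : (FinLp p' n →ₗ[ℝ] X) → FinLp p n ⊗[ℝ] X) := by
  intro u v h
  refine (PiLp.basisFun p' ℝ (Fin n)).ext fun i => ?_
  have := congrArg (fun z => TensorProduct.equivFinsuppOfBasisLeft
    (PiLp.basisFun p ℝ (Fin n)) z i) h
  simpa [coordTensor, Pi.single_apply, Finset.sum_ite_eq] using this

/-- The `X`-coordinates of a tensor along the basis of `ℓ^p_n` can be prescribed freely as the
values of a map on the basis of `ℓ^{p'}_n`. -/
theorem coordTensor_surjective :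
    Function.Surjective (coordTensor p : (FinLp p' n →ₗ[ℝ] X) → FinLp p n ⊗[ℝ] X) := by
  intro w
  obtain ⟨c, rfl⟩ := TensorProduct.eq_repr_basis_left (PiLp.basisFun p ℝ (Fin n)) w
  refine ⟨(PiLp.basisFun p' ℝ (Fin n)).constr ℝ c, ?_⟩
  rw [Finsupp.sum_fintype _ _ (by simp)]
  simp only [coordTensor, Module.Basis.constr_basis]

/-- The tensor of the identity of `ℓ^{p'}_n` has injective norm at most `1`. -/
theorem injectiveTensorNorm_coordTensor_id_le [Fact (1 ≤ p')]
    (hp : ENNReal.HolderConjugate p p') :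
    injectiveTensorNorm (FinLp p n) (FinLp p' n) (coordTensor p LinearMap.id) ≤ 1 := by
  refine injectiveTensorNorm_le fun f φ hf hφ => ?_
  let e := PiLp.basisFun p ℝ (Fin n)
  let e' := PiLp.basisFun p' ℝ (Fin n)
  -- `b` represents `f` in `ℓ^{p'}_n`, and pairing `f ⊗ φ` with the tensor of the identity gives `φ
  -- b`.
  let b : FinLp p' n := WithLp.toLp p' fun i => f (e i)
  have hb : ‖b‖ ≤ 1 := by
    refine FinLp.norm_le_of_forall_sum_mul_le hp b zero_le_one fun a => ?_
    have h1 : ∑ i, a i * b i = f a := by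
      conv_rhs => rw [← e.sum_repr a]
      simp [b, e]
    rw [h1]
    exact (le_abs_self _).trans (f.le_of_opNorm_le hf a)
  have h2 : tensorPairing f φ (coordTensor p LinearMap.id) = φ b := by
    conv_rhs => rw [← e'.sum_repr b]
    simp [coordTensor, b, e, e']
  rw [h2]
  exact (φ.le_of_opNorm_le hφ b).trans (by simpa using hb)

/-- Every tensor in `ℓ^p_m ⊗ ℓ^{p'}_n` is the image of the tensor of the identity under an
operator `ℓ^p_n → ℓ^p_m` of norm at most its injective norm. -/
theorem exists_rTensor_coordTensor_id_eq [Fact (1 ≤ p')]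
    (hp : ENNReal.HolderConjugate p p') {m : ℕ} (w : FinLp p m ⊗[ℝ] FinLp p' n) :
    ∃ T : FinLp p n →L[ℝ] FinLp p m,
      (T : FinLp p n →ₗ[ℝ] FinLp p m).rTensor _ (coordTensor p LinearMap.id) = w ∧
      ‖T‖ ≤ injectiveTensorNorm (FinLp p m) (FinLp p' n) w := by
  let e := PiLp.basisFun p ℝ (Fin n)
  let e' := PiLp.basisFun p' ℝ (Fin n)
  obtain ⟨c, hc⟩ := TensorProduct.eq_repr_basis_right e' w
  rw [Finsupp.sum_fintype _ _ (by simp)] at hc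
  let T : FinLp p n →L[ℝ] FinLp p m := LinearMap.toContinuousLinearMap (e.constr ℝ c)
  have hTe : ∀ i, T (e i) = c i := fun i => e.constr_basis ℝ c i
  have hT : ∀ a : FinLp p n, T a = ∑ i, a i • c i := fun a => by
    conv_lhs => rw [← e.sum_repr a]
    simp only [map_sum, map_smul, hTe]
    simp [e]
  refine ⟨T, ?_, ?_⟩
  · rw [← hc]
    simp only [coordTensor, map_sum, LinearMap.rTensor_tmul]
    exact Finset.sum_congr rfl fun i _ => congrArg (· ⊗ₜ[ℝ] e' i) (hTe i)
  · refine T.opNorm_le_bound (apply_nonneg _ _) fun a => ?_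
    obtain ⟨f, hf, hfa⟩ := exists_dual_vector'' ℝ (T a)
    -- `φ` is the pairing with `a`, so `⟨f ⊗ φ, w⟩ = f (T a)`; Hölder gives `‖φ‖ ≤ ‖a‖`.
    let φ : StrongDual ℝ (FinLp p' n) := LinearMap.mkContinuous
      (∑ i, a i • (PiLp.proj (𝕜 := ℝ) p' (fun _ : Fin n => ℝ) i).toLinearMap) ‖a‖ fun b => by
        simpa using FinLp.abs_sum_mul_le hp a b
    have hφ : ‖φ‖ ≤ ‖a‖ := LinearMap.mkContinuous_norm_le _ (norm_nonneg _) _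
    have hφ' : ∀ i, φ (e' i) = a i := fun i => by simp [φ, e']
    have h1 : tensorPairing f φ w = ‖T a‖ := by
      rw [← hc, map_sum]
      simp only [tensorPairing_tmul, hφ']
      have : f (T a) = ‖T a‖ := hfa
      rw [← this, hT, map_sum]
      simp [mul_comm]
    have h2 := abs_tensorPairing_le_injectiveTensorNorm f φ w
    rw [h1, abs_norm] at h2
    have h0 : 0 ≤ injectiveTensorNorm (FinLp p m) (FinLp p' n) w := apply_nonneg _ _
    calc ‖T a‖ ≤ ‖f‖ * ‖φ‖ * injectiveTensorNorm (FinLp p m) (FinLp p' n) w := h2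
      _ ≤ 1 * ‖a‖ * injectiveTensorNorm (FinLp p m) (FinLp p' n) w := by gcongr
      _ = _ := by ring

end CoordTensor

/-! ### The norm identity and the lifting. -/

namespace Multinorm

variable {p p' : ℝ≥0∞} [Fact (1 ≤ p)] [Fact (1 ≤ p')] {n : ℕ}
  {X : Type*} [NormedAddCommGroup X] [NormedSpace ℝ X]
  {Y : Type*} [NormedAddCommGroup Y] [NormedSpace ℝ Y]

/-- The `p`-norm of `u : min_p(ℓ^{p'}_n) → X` is the norm of its tensor in `ℓ^p_n ⊗ X`. -/
theorem opNorm_minimal_eq (hp : ENNReal.HolderConjugate p p') (A : Multinorm p X)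
    (u : FinLp p' n →ₗ[ℝ] X) :
    opNorm (minimal p (FinLp p' n)) A u = ENNReal.ofReal (A.norm n (coordTensor p u)) := by
  apply le_antisymm
  · refine iSup_le fun m => iSup_le fun w => iSup_le fun hw => ENNReal.ofReal_le_ofReal ?_
    obtain ⟨T, hTw, hT⟩ := exists_rTensor_coordTensor_id_eq hp w
    -- `T` and `u` act on different tensor factors, so they commute.
    have h1 : u.lTensor (FinLp p m) w =
        (T : FinLp p n →ₗ[ℝ] FinLp p m).rTensor X (coordTensor p u) := by
      rw [← hTw]
      simp [coordTensor]
    rw [h1]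
    refine (A.tensorial n m T _).trans ?_
    exact mul_le_of_le_one_left (apply_nonneg _ _) (hT.trans hw)
  · have h := lTensor_coordTensor (p := p) u (LinearMap.id : FinLp p' n →ₗ[ℝ] FinLp p' n)
    rw [LinearMap.comp_id] at h
    rw [← h]
    exact le_iSup_of_le n (le_iSup_of_le (coordTensor p LinearMap.id)
      (le_iSup_of_le (injectiveTensorNorm_coordTensor_id_le hp) le_rfl))

/-- A map on `min_p(ℓ^{p'}_n)` lifts along a `p`-quotient map with any bound exceeding the norm of
its tensor. -/
theorem exists_lift_of_norm_coordTensor_lt (hp : ENNReal.HolderConjugate p p')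
    {A : Multinorm p X} {B : Multinorm p Y} {q : Y →ₗ[ℝ] X} (hq : IsQuotientMap B A q)
    (u : FinLp p' n →ₗ[ℝ] X) {c : ℝ} (hc : A.norm n (coordTensor p u) < c) :
    ∃ u' : FinLp p' n →ₗ[ℝ] Y, q ∘ₗ u' = u ∧
      opNorm (minimal p (FinLp p' n)) B u' ≤ ENNReal.ofReal c := by
  have hc0 : 0 < c := (apply_nonneg _ _).trans_lt hc
  -- The quotient property concerns open balls, hence the strict inequality in `hc`.
  have hz : c⁻¹ • coordTensor p u ∈ {z | A.norm n z < 1} := by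
    rw [Set.mem_ofPred_eq, map_smul_eq_mul, Real.norm_of_nonneg (inv_nonneg.2 hc0.le),
      inv_mul_lt_one₀ hc0]
    exact hc
  rw [← hq n] at hz
  obtain ⟨w, hw, hqw⟩ := hz
  obtain ⟨u', hu'⟩ := coordTensor_surjective (p' := p') (c • w)
  refine ⟨u', coordTensor_injective (p := p) ?_, ?_⟩
  · rw [← lTensor_coordTensor, hu', map_smul, hqw, smul_inv_smul₀ hc0.ne']
  · rw [opNorm_minimal_eq hp, hu', map_smul_eq_mul, Real.norm_of_nonneg hc0.le]
    exact ENNReal.ofReal_le_ofReal (mul_le_of_le_one_right hc0.le hw.le)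

end Multinorm

/-! ### Additive and multiplicative bounds. -/

theorem mainTheorem3 (p p' : ℝ≥0∞) [Fact (1 ≤ p)] [Fact (1 ≤ p')]
    (hp : ENNReal.HolderConjugate p p') (n : ℕ) :
    Multinorm.IsOneProjective.{0, v, w} (Multinorm.minimal p (FinLp p' n)) ∧
    ∀ (X : Type v) [NormedAddCommGroup X] [NormedSpace ℝ X] [CompleteSpace X]
      (Y : Type w) [NormedAddCommGroup Y] [NormedSpace ℝ Y] [CompleteSpace Y]
      (A : Multinorm p X) (B : Multinorm p Y) (q : Y →ₗ[ℝ] X), Multinorm.IsQuotientMap B A q →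
      ∀ u : FinLp p' n →ₗ[ℝ] X,
        Multinorm.IsMultibounded (Multinorm.minimal p (FinLp p' n)) A u →
        ∀ ε : ℝ≥0, 0 < ε →
          ∃ u' : FinLp p' n →ₗ[ℝ] Y, q ∘ₗ u' = u ∧
            Multinorm.opNorm (Multinorm.minimal p (FinLp p' n)) B u' ≤
              (1 + ε) * Multinorm.opNorm (Multinorm.minimal p (FinLp p' n)) A u := by
  constructor
  · intro X _ _ _ Y _ _ _ A B q hq u _ ε hε
    obtain ⟨u', hqu, hu'⟩ := Multinorm.exists_lift_of_norm_coordTensor_lt hp hq u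
      (lt_add_of_pos_right (A.norm n (coordTensor p u)) (NNReal.coe_pos.2 hε))
    refine ⟨u', hqu, hu'.trans_eq ?_⟩
    rw [Multinorm.opNorm_minimal_eq hp, ENNReal.ofReal_add (apply_nonneg _ _) ε.coe_nonneg,
      ENNReal.ofReal_coe_nnreal]
  · intro X _ _ _ Y _ _ _ A B q hq u _ ε hε
    rcases (apply_nonneg (A.norm n) (coordTensor p u)).eq_or_lt with h0 | h0
    -- Here `(1 + ε) * 0` leaves no strict room above the norm, but definiteness forces `u = 0`,
    -- which lifts to 0.
    · have hu : u = 0 := coordTensor_injective (p := p) <| by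
        rw [A.eq_zero_of_norm_eq_zero n _ h0.symm]
        simp [coordTensor]
      refine ⟨0, by rw [hu, LinearMap.comp_zero], ?_⟩
      simp [Multinorm.opNorm_minimal_eq hp, coordTensor]
    · have hε' : (0 : ℝ) < ε := NNReal.coe_pos.2 hε
      obtain ⟨u', hqu, hu'⟩ := Multinorm.exists_lift_of_norm_coordTensor_lt hp hq u
        (c := (1 + ε) * A.norm n (coordTensor p u)) (by nlinarith)
      refine ⟨u', hqu, hu'.trans_eq ?_⟩
      rw [Multinorm.opNorm_minimal_eq hp, ENNReal.ofReal_mul (by positivity),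
        ENNReal.ofReal_add zero_le_one ε.coe_nonneg, ENNReal.ofReal_one, ENNReal.ofReal_coe_nnreal]
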